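/- Let $K$ be a field and let $G$ be a finite unmixed bipartite graph without isolated vertices (unmixed: all minimal vertex covers have the same cardinality), with bipartition $W\cup W'$, $W=\{x_1,\dots,x_n\}$, $W'=\{y_1,\dots,y_n\}$. Let $\mathcal L_G$ be the set, ordered by inclusion, of all subsets $\alpha\subseteq\{p_1,\dots,p_n\}$ for which there is a minimal vertex cover $C$ of $G$ such that $p_k\in\alpha\Leftrightarrow x_k\in C$ for all $k$, and let $\Delta(\mathcal L_G)$ be its order complex, whose faces are the chains of $\mathcal L_G$. Its $h$-vector is the coefficient sequence $(h_j)_{j\ge 0}$ of $\sum_{i=0}^{d} f_{i-1}z^i(1-z)^{d-i}$, where $f_{i-1}$ is the number of chains with $i$ elements ($f_{-1}=1$) and $d$ is the largest number of elements of a chain. Let $R=K[x_1,\dots,x_n,y_1,\dots,y_n]$ with maximal graded ideal $\mathfrak m$ (generated by the variables). For $k\ge 0$, a $k$-vertex cover of $G$ is a vector $c$ of non-negative integers indexed by the vertices such that $c_v+c_w\ge k$ for every edge $\{v,w\}$. Let $A(G)\subseteq R[t]$ be the subalgebra generated by all monomials $x^{c}t^{k}$ with $k\ge 0$ and $c$ a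 $k$-vertex cover, where $x^c$ denotes the monomial of $R$ with exponent vector $c$. The basic cover algebra is $\bar A(G)=A(G)/\mathfrak m A(G)$, graded by the degree in $t$. Its $h$-vector is the coefficient sequence of $h(z)=(1-z)^{\dim \bar A(G)}H_{\bar A(G)}(z)$, where $H_{\bar A(G)}(z)=\sum_{k\ge 0}\dim_K(\bar A(G)_k)\,z^k$ is the Hilbert series and $\dim \bar A(G)$ is the Krull dimension. Then $\bar A(G)$ has finite-dimensional graded components and finite Krull dimension, and the graded $K$-algebra $\bar A(G)$ and the order complex $\Delta(\mathcal L_G)$ have the same $h$-vector. -/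

import Mathlib

/-! ## Graphs, covers and the lattice of minimal vertex covers -/

namespace CoverAlgebra

/-- `C` is a minimal vertex cover of `G` (minimal with respect to inclusion). -/
def IsMinimalVertexCover {V : Type*} (G : SimpleGraph V) (C : Set V) : Prop :=
  Minimal G.IsVertexCover C

/-- `G` is unmixed: all minimal vertex covers have the same cardinality. -/
def IsUnmixed {V : Type*} (G : SimpleGraph V) : Prop :=
  ∀ C D : Set V, IsMinimalVertexCover G C → IsMinimalVertexCover G D → C.encard = D.encard

/-- `G` has no isolated vertices. -/
def NoIsolatedVertices {V : Type*} (G : SimpleGraph V) : Prop :=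
  ∀ v, ∃ w, G.Adj v w

/-- For a graph on `{x_1, …, x_n} ∪ {y_1, …, y_n}`, where `x_k` is `Sum.inl k` and `y_k` is
`Sum.inr k`: the set of all `α ⊆ {p_1, …, p_n}` for which there is a minimal vertex cover `C` with
`p_k ∈ α ↔ x_k ∈ C`. The element `p_k` is represented by its index `k`, and the order is
inclusion. -/
def coverLattice {n : ℕ} (G : SimpleGraph (Fin n ⊕ Fin n)) : Set (Set (Fin n)) :=
  {α | ∃ C, IsMinimalVertexCover G C ∧ ∀ k, k ∈ α ↔ Sum.inl k ∈ C}

/-! ## Simplicial complexes: order complex, `f`-vector, `h`-vector -/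

/-- The order complex of a poset: its (nonempty) faces are the nonempty finite chains. -/
def orderComplex (P : Type*) [PartialOrder P] : AbstractSimplicialComplex P where
  faces := {s | s.Nonempty ∧ IsChain (· ≤ ·) (s : Set P)}
  isRelLowerSet_faces := fun _ hs =>
    ⟨hs.1, fun _ hts ht => ⟨ht, hs.2.mono (Finset.coe_subset.mpr hts)⟩⟩
  singleton_mem := fun v => ⟨Finset.singleton_nonempty v, by simp⟩

/-- `f_{i-1}`, the number of faces with `i` vertices; `f_{-1} = 1` counts the empty face, which
is not among the `faces` of Mathlib's simplicial complexes. -/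
noncomputable def numFaces {P : Type*} (Δ : AbstractSimplicialComplex P) (i : ℕ) : ℕ :=
  if i = 0 then 1 else {s : Finset P | s ∈ Δ.faces ∧ s.card = i}.ncard

/-- `d = dim Δ + 1`, the largest number of vertices of a face of a finite complex. -/
noncomputable def dimSucc {P : Type*} (Δ : AbstractSimplicialComplex P) : ℕ :=
  sSup (Finset.card '' Δ.faces)

open Polynomial in
/-- The `h`-polynomial `∑_{i=0}^{d} f_{i-1} z^i (1 - z)^{d-i}` of a finite simplicial complex of
dimension `d - 1`. -/
noncomputable def complexHPolynomial {P : Type*} [Finite P] (Δ : AbstractSimplicialComplex P) :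
    Polynomial ℤ :=
  ∑ i ∈ Finset.range (dimSucc Δ + 1),
    C (numFaces Δ i : ℤ) * X ^ i * (1 - X) ^ (dimSucc Δ - i)

/-- The `h`-vector `(h_j)_{j ≥ 0}` of a finite simplicial complex, `h_j = 0` for `j > d`. -/
noncomputable def complexHVector {P : Type*} [Finite P] (Δ : AbstractSimplicialComplex P) :
    ℕ → ℤ :=
  fun j => (complexHPolynomial Δ).coeff j

/-! ## Graded algebras: Hilbert series and `h`-vector -/

/-- The Hilbert series `∑_k dim_K(𝒜_k) z^k` of a graded `K`-algebra. -/
noncomputable def hilbertSeries {K A : Type*} [Field K] [CommRing A] [Algebra K A]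
    (𝒜 : ℕ → Submodule K A) [GradedAlgebra 𝒜] : PowerSeries ℤ :=
  PowerSeries.mk fun k => (Module.finrank K (𝒜 k) : ℤ)

/-- The `h`-vector `(h_j)_{j ≥ 0}` of a graded `K`-algebra `A` of finite Krull dimension `d`: the
coefficients of `h(z) = (1 - z)^d H_A(z)`, so that `H_A(z) = h(z) / (1 - z)^d`. -/
noncomputable def algebraHVector {K A : Type*} [Field K] [CommRing A] [Algebra K A]
    (𝒜 : ℕ → Submodule K A) [GradedAlgebra 𝒜] : ℕ → ℤ :=
  fun j => PowerSeries.coeff j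
    ((1 - PowerSeries.X) ^ ((ringKrullDim A).unbotD 0).toNat * hilbertSeries 𝒜)

/-! ## Reduction of a subalgebra of `R[t]` modulo an ideal of `R` -/

section Fiber

variable (K : Type*) {R : Type*} [Field K] [CommRing R] [Algebra K R]
  (S : Subalgebra R (Polynomial R)) (m : Ideal R)

/-- The ring `S / m S`, for an `R`-subalgebra `S` of `R[t]` and an ideal `m` of `R`. -/
def Fiber : Type _ := S ⧸ m.map (algebraMap R S)

noncomputable instance : CommRing (Fiber S m) :=
  inferInstanceAs (CommRing (S ⧸ m.map (algebraMap R S)))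

noncomputable instance : Algebra K (Fiber S m) :=
  inferInstanceAs (Algebra K (S ⧸ m.map (algebraMap R S)))

/-- The residue class map `S → S / m S`. -/
noncomputable def Fiber.mk : S →ₐ[K] Fiber S m :=
  Ideal.Quotient.mkₐ K (m.map (algebraMap R S))

/-- The elements of `S` of degree `k` in `t`, that is, of the form `r t^k`. -/
noncomputable def tComponent (k : ℕ) : Submodule K S where
  carrier := {a | ∃ r, (a : Polynomial R) = Polynomial.monomial k r}
  add_mem' := by
    rintro a b ⟨r, hr⟩ ⟨s, hs⟩
    exact ⟨r + s, by simp [hr, hs]⟩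
  zero_mem' := ⟨0, by simp⟩
  smul_mem' := by
    rintro c a ⟨r, hr⟩
    refine ⟨c • r, ?_⟩
    rw [← Polynomial.smul_monomial, ← hr]
    rfl

/-- The component of `t`-degree `k` of `S / m S`: the image of the one of `S`. -/
noncomputable def fiberComponent (k : ℕ) : Submodule K (Fiber S m) :=
  (tComponent K S k).map (Fiber.mk K S m).toLinearMap

instance : SetLike.GradedMonoid (fiberComponent K S m) where
  one_mem := ⟨1, ⟨1, by simp⟩, map_one (Fiber.mk K S m)⟩
  mul_mem := by
    rintro i j _ _ ⟨a, ⟨r, hr⟩, rfl⟩ ⟨b, ⟨s, hs⟩, rfl⟩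
    refine ⟨a * b, ⟨r * s, ?_⟩, map_mul (Fiber.mk K S m) a b⟩
    rw [← Polynomial.monomial_mul_monomial, ← hr, ← hs]
    rfl

variable {S}

/-- The projection of `S` to its component of `t`-degree `k`, for `S` homogeneous in `t`. -/
noncomputable def tProj (hS : ∀ f ∈ S, ∀ k, Polynomial.monomial k (f.coeff k) ∈ S) (k : ℕ) :
    S →ₗ[R] S where
  toFun a := ⟨Polynomial.monomial k ((a : Polynomial R).coeff k), hS a a.2 k⟩
  map_add' a b := by ext1; simp
  map_smul' r a := by ext1; simp [Polynomial.smul_monomial]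

variable (hS : ∀ f ∈ S, ∀ k, Polynomial.monomial k (f.coeff k) ∈ S)

theorem tProj_mem_ideal (k : ℕ) {a : S} (ha : a ∈ m.map (algebraMap R S)) :
    tProj hS k a ∈ m.map (algebraMap R S) := by
  rw [← Submodule.restrictScalars_mem R, ← Ideal.smul_top_eq_map] at ha ⊢
  have h := Submodule.mem_map_of_mem (f := tProj hS k) ha
  rw [Submodule.map_smul''] at h
  exact Submodule.smul_mono le_rfl le_top h

theorem tProj_of_mem {k : ℕ} {a : S} (ha : a ∈ tComponent K S k) (l : ℕ) :
    tProj hS l a = if l = k then a else 0 := by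
  obtain ⟨r, hr⟩ := ha
  apply Subtype.ext
  change Polynomial.monomial l ((a : Polynomial R).coeff l) = _
  split_ifs with h
  · subst h; simp [hr]
  · rw [hr, Polynomial.coeff_monomial, if_neg (fun h' => h h'.symm)]; simp

theorem sum_tProj (a : S) :
    ∑ k ∈ (a : Polynomial R).support, tProj hS k a = a := by
  apply Subtype.ext
  conv_rhs => rw [Polynomial.as_sum_support (a : Polynomial R)]
  rw [AddSubmonoidClass.coe_finsetSum]
  rfl

/-- The projection of `S / m S` to its component of degree `k`, for `S` homogeneous in `t`. -/
noncomputable def fiberProj (k : ℕ) : Fiber S m →ₗ[K] Fiber S m :=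
  Submodule.mapQ ((m.map (algebraMap R S)).restrictScalars K)
    ((m.map (algebraMap R S)).restrictScalars K)
    ((tProj hS k).restrictScalars K) (fun _ ha => tProj_mem_ideal m hS k ha)

theorem fiberProj_mk (k : ℕ) (a : S) :
    fiberProj K m hS k (Fiber.mk K S m a) = Fiber.mk K S m (tProj hS k a) := rfl

theorem fiberProj_of_mem {k : ℕ} {b : Fiber S m} (hb : b ∈ fiberComponent K S m k) (l : ℕ) :
    fiberProj K m hS l b = if l = k then b else 0 := by
  obtain ⟨a, ha, rfl⟩ := hb
  change fiberProj K m hS l (Fiber.mk K S m a) = _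
  rw [fiberProj_mk, tProj_of_mem K hS ha]
  split_ifs with h
  · rfl
  · exact map_zero (Fiber.mk K S m)

theorem fiber_isInternal (hS : ∀ f ∈ S, ∀ k, Polynomial.monomial k (f.coeff k) ∈ S) :
    DirectSum.IsInternal (fiberComponent K S m) := by
  apply DirectSum.isInternal_submodule_of_iSupIndep_of_iSup_eq_top
  · rw [iSupIndep_def]
    intro k
    rw [Submodule.disjoint_def]
    intro b hb hb'
    have h1 := fiberProj_of_mem K m hS hb k
    rw [if_pos rfl] at h1
    have h2 : (⨆ j, ⨆ (_ : j ≠ k), fiberComponent K S m j) ≤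
        LinearMap.ker (fiberProj K m hS k) := by
      refine iSup₂_le fun j hj c hc => ?_
      rw [LinearMap.mem_ker, fiberProj_of_mem K m hS hc, if_neg hj.symm]
    rw [← h1]
    exact h2 hb'
  · rw [eq_top_iff]
    intro b _
    obtain ⟨a, rfl⟩ := Ideal.Quotient.mk_surjective b
    change Fiber.mk K S m a ∈ _
    rw [← sum_tProj hS a, map_sum]
    refine sum_mem fun k _ => Submodule.mem_iSup_of_mem k ?_
    exact ⟨_, ⟨_, rfl⟩, rfl⟩

end Fiber

/-! ## The vertex cover algebra and the basic cover algebra -/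

section Cover

variable {V : Type*} (K : Type*) [Field K] (G : SimpleGraph V)

/-- `c` is a `k`-vertex cover of `G`. -/
def IsKVertexCover {V : Type*} (G : SimpleGraph V) (k : ℕ) (c : V →₀ ℕ) : Prop :=
  ∀ v w, G.Adj v w → k ≤ c v + c w

/-- The vertex cover algebra `A(G)`: the subalgebra of `R[t]`, `R = K[x_v : v ∈ V]`, generated by
all monomials `x^c t^k` with `c` a `k`-vertex cover of `G`. (For `k = 0` these include all the
variables of `R`, so the `K`-subalgebra generated is the same as the `R`-subalgebra.) -/
noncomputable def vertexCoverAlgebra :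
    Subalgebra (MvPolynomial V K) (Polynomial (MvPolynomial V K)) :=
  Algebra.adjoin (MvPolynomial V K)
    {f | ∃ (k : ℕ) (c : V →₀ ℕ), IsKVertexCover G k c ∧
      f = Polynomial.monomial k (MvPolynomial.monomial c (1 : K))}

/-- The maximal graded ideal `𝔪` of `K[x_v : v ∈ V]`. -/
noncomputable def maximalGradedIdeal (V K : Type*) [Field K] : Ideal (MvPolynomial V K) :=
  Ideal.span (Set.range MvPolynomial.X)

/-- The basic cover algebra `A(G) / 𝔪 A(G)`. -/
abbrev BasicCoverAlgebra : Type _ :=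
  Fiber (vertexCoverAlgebra K G) (maximalGradedIdeal V K)

/-- The homogeneous component of degree `k` of the basic cover algebra: the image of the component
of `t`-degree `k` of `A(G)`. The classes of the generators `m t` of `A(G)`, with `m` the monomial
of a minimal vertex cover, have degree `1`. -/
noncomputable abbrev basicCoverComponent (k : ℕ) : Submodule K (BasicCoverAlgebra K G) :=
  fiberComponent K (vertexCoverAlgebra K G) (maximalGradedIdeal V K) k

theorem monomial_coeff_mem {K : Type*} [Field K] {G : SimpleGraph V}
    {f : Polynomial (MvPolynomial V K)} (hf : f ∈ vertexCoverAlgebra K G) :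
    ∀ k, Polynomial.monomial k (f.coeff k) ∈ vertexCoverAlgebra K G := by
  classical
  unfold vertexCoverAlgebra at hf
  induction hf using Algebra.adjoin_induction with
  | mem f hf =>
    intro k
    obtain ⟨l, c, hc, rfl⟩ := hf
    rw [Polynomial.coeff_monomial]
    split_ifs with h
    · subst h
      exact Algebra.subset_adjoin ⟨l, c, hc, rfl⟩
    · simp
  | algebraMap r =>
    intro k
    rw [Polynomial.algebraMap_apply, Algebra.algebraMap_self_apply, Polynomial.coeff_C]
    split_ifs with h
    · subst h
      exact Subalgebra.algebraMap_mem _ r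
    · simp
  | add f g _ _ hf hg =>
    intro k
    rw [Polynomial.coeff_add, map_add]
    exact add_mem (hf k) (hg k)
  | mul f g _ _ hf hg =>
    intro k
    rw [Polynomial.coeff_mul, map_sum]
    refine sum_mem fun p hp => ?_
    rw [← Finset.HasAntidiagonal.mem_antidiagonal.mp hp, ← Polynomial.monomial_mul_monomial]
    exact mul_mem (hf _) (hg _)

/-- The basic cover algebra is a graded `K`-algebra. -/
noncomputable instance : GradedAlgebra (basicCoverComponent K G) where
  toDecomposition := (fiber_isInternal K (maximalGradedIdeal V K)
    (fun _ hf => monomial_coeff_mem hf)).chooseDecomposition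

end Cover

end CoverAlgebra

namespace CoverAlgebra

/-! ## Krull dimension of finitely generated domains over a field -/

section KrullDimension

/-! The side `W` is a minimal vertex cover, so unmixedness gives every minimal cover exactly `n`
elements. From a `(k+1)`-cover `c` one can peel off the cover `headSet (k + 1) c`, and a `k`-cover
remains. Peeling shows that a `k`-cover has degree at least `k * n`, and that one of larger degree
is a `k`-cover plus a unit vector, so its monomial lies in `𝔪 A(G)`. The excess `|c| - k * n` is
therefore a nonnegative grading on `A(G)`, and its part of excess zero is a copy of the basic cover
algebra inside `K[x, y][t]` (`fiberEmbedding_injective`).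

Peeling a `k`-cover of degree `k * n` yields minimal covers whose traces on `W` form a multichain in
the lattice, and this multichain can be recovered from the sum (`exists_multichain_coverSum_eq`,
`coverSum_injOn`). The Hilbert function thus counts multichains. Grouped by support, these have
generating function `∑ f_{i-1} (z / (1 - z))^i`, which is the `h`-polynomial of the order complex
divided by `(1 - z)^d`.

It remains to see that the Krull dimension is `d`. The generators belonging to a maximal chain are
algebraically independent, since distinct multichains give distinct monomials. Every other generator
is algebraic over them: multiplied by a suitable monomial in the chain, it becomes again a monomial
in the chain (`exists_coverSum_single_add_eq`). So they form a transcendence basis, and Noether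
normalization turns its cardinality into the Krull dimension. -/

theorem ringKrullDim_eq_of_isIntegral {R S : Type*} [CommRing R] [CommRing S] [Algebra R S]
    [Algebra.IsIntegral R S] (hinj : Function.Injective (algebraMap R S)) :
    ringKrullDim S = ringKrullDim R := by
  apply le_antisymm
  -- Incomparability: contraction of primes along an integral map is strictly monotone.
  · refine Order.krullDim_le_of_strictMono
      (fun P : PrimeSpectrum S => PrimeSpectrum.comap (algebraMap R S) P) ?_
    intro P Q h
    exact Ideal.IsIntegral.comap_lt_comap (R := R) h
  -- Lying over at the bottom of a chain (available since the kernel is zero), then going up along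
  -- the rest.
  · rw [ringKrullDim, Order.krullDim]
    refine iSup_le fun l => ?_
    obtain ⟨P, -, hP, hover⟩ := Ideal.exists_ideal_over_prime_of_isIntegral
      (S := S) (RelSeries.head l).asIdeal ⊥ (by
        rw [← RingHom.ker_eq_comap_bot, (RingHom.injective_iff_ker_eq_bot _).mp hinj]
        exact bot_le)
    have : P.LiesOver (RelSeries.head l).asIdeal := ⟨hover.symm⟩
    obtain ⟨l', hl', -⟩ := Ideal.exists_ltSeries_of_hasGoingUp l P
    rw [← hl']
    exact Order.LTSeries.length_le_krullDim l'

/-- Noether normalization makes `A` integral over a polynomial ring in `s` variables. These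
variables are also a transcendence basis, and any two such bases have the same cardinality. -/
theorem _root_.IsTranscendenceBasis.ringKrullDim_eq {k A ι : Type*} [Field k] [CommRing A]
    [IsDomain A] [Algebra k A] [Algebra.FiniteType k A] [Finite ι] {x : ι → A}
    (hx : IsTranscendenceBasis k x) : ringKrullDim A = (Nat.card ι : ℕ) := by
  obtain ⟨s, g, hg, hint⟩ := exists_integral_inj_algHom_of_fg k A
  algebraize [g.toRingHom]
  have : IsScalarTower k (MvPolynomial (Fin s) k) A :=
    IsScalarTower.of_algebraMap_eq fun r => (g.commutes r).symm
  have hint' : Algebra.IsIntegral (MvPolynomial (Fin s) k) A := ⟨hint⟩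
  have : FaithfulSMul (MvPolynomial (Fin s) k) A :=
    (faithfulSMul_iff_algebraMap_injective _ _).mpr hg
  have hb := (IsTranscendenceBasis.mvPolynomial (Fin s) k)
  have hd : ringKrullDim A = (s : ℕ) := by
    rw [ringKrullDim_eq_of_isIntegral (R := MvPolynomial (Fin s) k) (S := A) hg]
    simp
  have hb' : IsTranscendenceBasis k (fun i : Fin s => g (MvPolynomial.X i)) :=
    hb.algebraMap_comp (A := A)
  have hc := congrArg Cardinal.toNat (hx.lift_cardinalMk_eq hb')
  rw [hd]
  simp only [Cardinal.toNat_lift, Cardinal.mk_fin, Cardinal.toNat_natCast] at hc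
  rw [Nat.card, hc]

end KrullDimension

/-! ## Vertex covers of unmixed bipartite graphs -/

section Covers

variable {n : ℕ} {G : SimpleGraph (Fin n ⊕ Fin n)}

theorem isMinimalVertexCover_range_inl
    (hbip : G.IsBipartiteWith (Set.range Sum.inl) (Set.range Sum.inr))
    (hiso : NoIsolatedVertices G) :
    IsMinimalVertexCover G (Set.range Sum.inl) := by
  refine ⟨fun v w h => (hbip.mem_of_adj h).imp And.left And.right, fun D hD hle => ?_⟩
  rintro _ ⟨i, rfl⟩
  obtain ⟨w, hw⟩ := hiso (Sum.inl i)
  refine (hD hw).resolve_right fun h => ?_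
  obtain ⟨j, rfl⟩ := hle h
  simpa using hbip.mem_of_adj hw

theorem encard_of_isMinimalVertexCover
    (hbip : G.IsBipartiteWith (Set.range Sum.inl) (Set.range Sum.inr))
    (hiso : NoIsolatedVertices G) (hunm : IsUnmixed G) {C : Set (Fin n ⊕ Fin n)}
    (hC : IsMinimalVertexCover G C) : C.encard = n := by
  rw [hunm C _ hC (isMinimalVertexCover_range_inl hbip hiso), ← Set.image_univ,
    Sum.inl_injective.encard_image]
  simp

theorem le_encard_of_isVertexCover
    (hbip : G.IsBipartiteWith (Set.range Sum.inl) (Set.range Sum.inr))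
    (hiso : NoIsolatedVertices G) (hunm : IsUnmixed G) {C : Set (Fin n ⊕ Fin n)}
    (hC : G.IsVertexCover C) : n ≤ C.encard := by
  obtain ⟨D, hD, hmin⟩ := (Set.toFinite {D | G.IsVertexCover D}).exists_le_minimal hC
  rw [← encard_of_isMinimalVertexCover hbip hiso hunm hmin]
  exact Set.encard_le_encard hD

theorem isMinimalVertexCover_of_encard_eq
    (hbip : G.IsBipartiteWith (Set.range Sum.inl) (Set.range Sum.inr))
    (hiso : NoIsolatedVertices G) (hunm : IsUnmixed G) {C : Set (Fin n ⊕ Fin n)}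
    (hC : G.IsVertexCover C) (hcard : C.encard = n) : IsMinimalVertexCover G C :=
  ⟨hC, fun _ hD hle => ((Set.toFinite C).eq_of_subset_of_encard_le' hle
    (hcard.trans_le (le_encard_of_isVertexCover hbip hiso hunm hD))).ge⟩

theorem IsKVertexCover.add {V : Type*} {G : SimpleGraph V} {k l : ℕ} {c d : V →₀ ℕ}
    (hc : IsKVertexCover G k c) (hd : IsKVertexCover G l d) :
    IsKVertexCover G (k + l) (c + d) := by
  intro v w h
  have h1 := hc v w h
  have h2 := hd v w h
  simp only [Finsupp.add_apply]
  omega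

theorem isKVertexCover_zero {V : Type*} {G : SimpleGraph V} (c : V →₀ ℕ) :
    IsKVertexCover G 0 c := fun _ _ _ => Nat.zero_le _

open Classical in
/-- The indicator vector of a set of vertices. -/
noncomputable def indicatorVec {V : Type*} [Finite V] (C : Set V) : V →₀ ℕ :=
  Finsupp.equivFunOnFinite.symm fun v => if v ∈ C then 1 else 0

open Classical in
theorem indicatorVec_apply {V : Type*} [Finite V] (C : Set V) (v : V) :
    indicatorVec C v = if v ∈ C then 1 else 0 := rfl

theorem degree_indicatorVec {V : Type*} [Finite V] (C : Set V) :
    ((indicatorVec C).degree : ℕ∞) = C.encard := by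
  classical
  have := Fintype.ofFinite V
  rw [Finsupp.degree_eq_sum, Set.encard_eq_coe_toFinset_card]
  simp [indicatorVec_apply, Set.toFinset_card, Fintype.card_subtype]

theorem isKVertexCover_indicatorVec {V : Type*} [Finite V] {G : SimpleGraph V} {C : Set V} :
    IsKVertexCover G 1 (indicatorVec C) ↔ G.IsVertexCover C := by
  classical
  refine forall_congr' fun v => forall_congr' fun w => forall_congr' fun _ => ?_
  rw [indicatorVec_apply, indicatorVec_apply]
  split_ifs <;> simp_all

/-- The set of `x_i` with `c(x_i) ≥ 1` and `y_j` with `c(y_j) ≥ k`. For a `k`-vertex cover `c` with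
`k ≥ 1`, this is a vertex cover. -/
def headSet (k : ℕ) (c : Fin n ⊕ Fin n →₀ ℕ) : Set (Fin n ⊕ Fin n) :=
  {v | v.elim (fun i => 1 ≤ c (Sum.inl i)) (fun j => k ≤ c (Sum.inr j))}

theorem isVertexCover_headSet
    (hbip : G.IsBipartiteWith (Set.range Sum.inl) (Set.range Sum.inr))
    {k : ℕ} {c : Fin n ⊕ Fin n →₀ ℕ} (hc : IsKVertexCover G k c) :
    G.IsVertexCover (headSet k c) := by
  intro v w h
  have h1 := hc v w h
  have h2 := hbip.mem_of_adj h
  rcases v with i | j <;> rcases w with i' | j' <;> simp [headSet] at h2 ⊢ <;> omega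

theorem indicatorVec_headSet_le {k : ℕ} (hk : 1 ≤ k) (c : Fin n ⊕ Fin n →₀ ℕ) :
    indicatorVec (headSet k c) ≤ c := by
  intro v
  rw [indicatorVec_apply]
  split_ifs with h
  · rcases v with i | j
    · exact h
    · exact hk.trans h
  · exact Nat.zero_le _

/-- On an edge `x_i y_j` the sum drops by 2 only if both ends lie in the head. Then `c(y_j) ≥ k +
1`, so `y_j` alone still contributes `k`. -/
theorem isKVertexCover_tail
    (hbip : G.IsBipartiteWith (Set.range Sum.inl) (Set.range Sum.inr))
    {k : ℕ} {c : Fin n ⊕ Fin n →₀ ℕ} (hc : IsKVertexCover G (k + 1) c) :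
    IsKVertexCover G k (c - indicatorVec (headSet (k + 1) c)) := by
  classical
  intro v w h
  have h1 := hc v w h
  have h2 := hbip.mem_of_adj h
  rcases v with i | j <;> rcases w with i' | j' <;>
    simp [headSet, indicatorVec_apply] at h2 ⊢ <;> grind

theorem tail_add_head {k : ℕ} (c : Fin n ⊕ Fin n →₀ ℕ) :
    c - indicatorVec (headSet (k + 1) c) + indicatorVec (headSet (k + 1) c) = c :=
  tsub_add_cancel_of_le (indicatorVec_headSet_le (Nat.le_add_left 1 k) c)

theorem le_degree_indicatorVec
    (hbip : G.IsBipartiteWith (Set.range Sum.inl) (Set.range Sum.inr))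
    (hiso : NoIsolatedVertices G) (hunm : IsUnmixed G) {C : Set (Fin n ⊕ Fin n)}
    (hC : G.IsVertexCover C) : n ≤ (indicatorVec C).degree := by
  have := le_encard_of_isVertexCover hbip hiso hunm hC
  rw [← degree_indicatorVec] at this
  exact_mod_cast this

theorem IsKVertexCover.le_degree
    (hbip : G.IsBipartiteWith (Set.range Sum.inl) (Set.range Sum.inr))
    (hiso : NoIsolatedVertices G) (hunm : IsUnmixed G) {k : ℕ} {c : Fin n ⊕ Fin n →₀ ℕ}
    (hc : IsKVertexCover G k c) : k * n ≤ c.degree := by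
  induction k generalizing c with
  | zero => simp
  | succ k ih =>
    have h1 := ih (isKVertexCover_tail hbip hc)
    have h2 := le_degree_indicatorVec hbip hiso hunm (isVertexCover_headSet hbip hc)
    rw [← tail_add_head (k := k) c, map_add, add_mul, one_mul]
    exact add_le_add h1 h2

/-- The `k`-vertex covers of minimal degree `k * n`. -/
def minimalCovers (G : SimpleGraph (Fin n ⊕ Fin n)) (k : ℕ) : Set (Fin n ⊕ Fin n →₀ ℕ) :=
  {c | IsKVertexCover G k c ∧ c.degree = k * n}

/-- Excess degree sits in the tail, where induction applies, or in the head, which then has more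
than `n` elements, is not minimal, and can lose a vertex. -/
theorem exists_isKVertexCover_sub_single
    (hbip : G.IsBipartiteWith (Set.range Sum.inl) (Set.range Sum.inr))
    (hiso : NoIsolatedVertices G) (hunm : IsUnmixed G) {k : ℕ} {c : Fin n ⊕ Fin n →₀ ℕ}
    (hc : IsKVertexCover G k c) (hdeg : k * n < c.degree) :
    ∃ d v, IsKVertexCover G k d ∧ c = d + Finsupp.single v 1 := by
  induction k generalizing c with
  | zero =>
    obtain ⟨v, hv⟩ : ∃ v, c v ≠ 0 := by
      by_contra! h
      rw [show c = 0 from Finsupp.ext h] at hdeg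
      simp at hdeg
    refine ⟨c - Finsupp.single v 1, v, isKVertexCover_zero _, ?_⟩
    rw [tsub_add_cancel_of_le]
    rw [Finsupp.single_le_iff]
    omega
  | succ k ih =>
    have ht := isKVertexCover_tail hbip hc
    have hh := isVertexCover_headSet hbip hc
    set C := headSet (k + 1) c
    have hsum : c - indicatorVec C + indicatorVec C = c := tail_add_head c
    by_cases hlt : k * n < (c - indicatorVec C).degree
    · obtain ⟨d, v, hd, hcd⟩ := ih ht hlt
      refine ⟨d + indicatorVec C, v, hd.add (isKVertexCover_indicatorVec.mpr hh), ?_⟩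
      rw [add_right_comm, ← hcd, hsum]
    · have hgt : n < (indicatorVec C).degree := by
        rw [← hsum, map_add, add_mul] at hdeg
        omega
      have hnot : ¬ IsMinimalVertexCover G C := fun h => by
        have := encard_of_isMinimalVertexCover hbip hiso hunm h
        rw [← degree_indicatorVec] at this
        have : (indicatorVec C).degree = n := by exact_mod_cast this
        omega
      obtain ⟨D, hDC, hD⟩ : ∃ D, D ⊂ C ∧ G.IsVertexCover D := by
        by_contra! h
        refine hnot ⟨hh, fun D hD hle => ?_⟩
        by_contra h'
        exact h D ⟨hle, h'⟩ hD
      obtain ⟨v, hvC, hvD⟩ := Set.exists_of_ssubset hDC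
      refine ⟨c - indicatorVec C + indicatorVec (C \ {v}), v,
        ht.add (isKVertexCover_indicatorVec.mpr (hD.subset ?_)), ?_⟩
      -- The smaller cover `D` avoids `v`, so `C \ {v}` contains it and is still a cover.
      · exact fun w hw => ⟨hDC.1 hw, fun h => hvD (h ▸ hw)⟩
      · rw [add_assoc]
        convert hsum.symm using 2
        classical
        ext w
        simp only [Finsupp.add_apply, indicatorVec_apply, Finsupp.single_apply, Set.mem_sdiff,
          Set.mem_singleton_iff]
        by_cases h : v = w
        · subst h; simp [hvC]
        · simp [h, Ne.symm h]

/-- The indicator vector of the minimal vertex cover belonging to an element of the lattice. -/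
noncomputable def coverVec (α : coverLattice G) : Fin n ⊕ Fin n →₀ ℕ :=
  indicatorVec α.2.choose

theorem coverVec_inl (α : coverLattice G) (i : Fin n) [Decidable (i ∈ α.1)] :
    coverVec α (Sum.inl i) = if i ∈ α.1 then 1 else 0 := by
  classical
  rw [coverVec, indicatorVec_apply]
  simp only [← α.2.choose_spec.2 i]

theorem coverVec_mem
    (hbip : G.IsBipartiteWith (Set.range Sum.inl) (Set.range Sum.inr))
    (hiso : NoIsolatedVertices G) (hunm : IsUnmixed G) (α : coverLattice G) :
    coverVec α ∈ minimalCovers G 1 := by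
  have h := α.2.choose_spec.1
  refine ⟨isKVertexCover_indicatorVec.mpr h.1, ?_⟩
  have := encard_of_isMinimalVertexCover hbip hiso hunm h
  rw [← degree_indicatorVec] at this
  rw [one_mul]
  exact_mod_cast this

/-- If `C` and `D` agree on `W`, then `C ∩ D` is still a cover: on an edge whose `x`-end lies in
neither, the `y`-end lies in both. Minimality then gives `C = C ∩ D = D`. -/
theorem IsMinimalVertexCover.ext_inl
    (hbip : G.IsBipartiteWith (Set.range Sum.inl) (Set.range Sum.inr))
    {C D : Set (Fin n ⊕ Fin n)} (hC : IsMinimalVertexCover G C) (hD : IsMinimalVertexCover G D)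
    (h : ∀ i, Sum.inl i ∈ C ↔ Sum.inl i ∈ D) : C = D := by
  have hCD : G.IsVertexCover (C ∩ D) := by
    intro v w hvw
    have h1 := hbip.mem_of_adj hvw
    have h2 := hC.1 hvw
    have h3 := hD.1 hvw
    rcases v with i | j <;> rcases w with i' | j' <;> simp at h1
    · have := h i
      simp only [Set.mem_inter_iff]; tauto
    · have := h i'
      simp only [Set.mem_inter_iff]; tauto
  exact le_antisymm (fun v hv => (hC.2 hCD Set.inter_subset_left hv).2)
    (fun v hv => (hD.2 hCD Set.inter_subset_right hv).1)

theorem exists_coverVec_eq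
    (hbip : G.IsBipartiteWith (Set.range Sum.inl) (Set.range Sum.inr))
    {C : Set (Fin n ⊕ Fin n)} (hC : IsMinimalVertexCover G C) :
    ∃ α : coverLattice G, coverVec α = indicatorVec C := by
  let α : coverLattice G := ⟨{i | Sum.inl i ∈ C}, C, hC, fun _ => Iff.rfl⟩
  refine ⟨α, ?_⟩
  rw [coverVec, IsMinimalVertexCover.ext_inl hbip α.2.choose_spec.1 hC
    fun i => (α.2.choose_spec.2 i).symm]

end Covers

/-! ## Multichains and minimal covers -/

section Multichains

/-- The multichains with `k` elements of a poset, given by their multiplicities. -/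
def multichains (P : Type*) [PartialOrder P] (k : ℕ) : Set (P →₀ ℕ) :=
  {m | IsChain (· ≤ ·) (m.support : Set P) ∧ m.degree = k}

variable {n : ℕ} {G : SimpleGraph (Fin n ⊕ Fin n)}

/-- The sum of the covers in a multiset of elements of the lattice. -/
noncomputable def coverSum (G : SimpleGraph (Fin n ⊕ Fin n)) :
    (coverLattice G →₀ ℕ) →+ (Fin n ⊕ Fin n →₀ ℕ) :=
  (Finsupp.linearCombination ℕ (coverVec (G := G))).toAddMonoidHom

theorem coverSum_single (α : coverLattice G) (a : ℕ) :
    coverSum G (Finsupp.single α a) = a • coverVec α :=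
  Finsupp.linearCombination_single ..

theorem coverSum_inl (m : coverLattice G →₀ ℕ) (i : Fin n)
    [DecidablePred fun α : coverLattice G => i ∈ α.1] :
    coverSum G m (Sum.inl i) = ∑ α ∈ m.support with i ∈ α.1, m α := by
  change Finsupp.linearCombination ℕ (coverVec (G := G)) m (Sum.inl i) = _
  rw [Finsupp.linearCombination_apply, Finsupp.sum, Finsupp.finsetSum_apply, Finset.sum_filter]
  refine Finset.sum_congr rfl fun α _ => ?_
  rw [Finsupp.smul_apply, coverVec_inl]
  simp

theorem coverSum_mem
    (hbip : G.IsBipartiteWith (Set.range Sum.inl) (Set.range Sum.inr))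
    (hiso : NoIsolatedVertices G) (hunm : IsUnmixed G) (m : coverLattice G →₀ ℕ) :
    coverSum G m ∈ minimalCovers G m.degree := by
  induction m using Finsupp.induction_linear with
  | zero => exact ⟨by simpa using isKVertexCover_zero _, by simp⟩
  | add f g hf hg =>
    rw [map_add, map_add]
    exact ⟨hf.1.add hg.1, by rw [map_add, hf.2, hg.2, add_mul]⟩
  | single α a =>
    obtain ⟨h1, h2⟩ := coverVec_mem hbip hiso hunm α
    rw [coverSum_single, Finsupp.degree_single]
    refine ⟨fun v w h => ?_, by rw [map_nsmul, h2]; simp⟩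
    have := h1 v w h
    simp only [Finsupp.smul_apply, smul_eq_mul, ← mul_add]
    exact Nat.le_mul_of_pos_right a this

/-- Equality in the degree bound forces equality for head and tail. So the head is a minimal cover,
and the tail is handled by induction. -/
theorem exists_multichain_coverSum_eq
    (hbip : G.IsBipartiteWith (Set.range Sum.inl) (Set.range Sum.inr))
    (hiso : NoIsolatedVertices G) (hunm : IsUnmixed G) {k : ℕ} {c : Fin n ⊕ Fin n →₀ ℕ}
    (hc : c ∈ minimalCovers G k) : ∃ m ∈ multichains (coverLattice G) k, coverSum G m = c := by
  classical
  induction k generalizing c with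
  | zero =>
    have h0 : c = 0 := by
      have := hc.2
      rwa [zero_mul, Finsupp.degree_eq_zero_iff] at this
    exact ⟨0, ⟨by simp, by simp⟩, by simp [h0]⟩
  | succ k ih =>
    obtain ⟨hc, hdeg⟩ := hc
    have ht := isKVertexCover_tail hbip hc
    have hh := isVertexCover_headSet hbip hc
    set C := headSet (k + 1) c with hCdef
    have hsum : c - indicatorVec C + indicatorVec C = c := tail_add_head c
    have ht' := ht.le_degree hbip hiso hunm
    have hh' := le_degree_indicatorVec hbip hiso hunm hh
    rw [← hsum, map_add, add_mul] at hdeg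
    have hmin : IsMinimalVertexCover G C := by
      refine isMinimalVertexCover_of_encard_eq hbip hiso hunm hh ?_
      rw [← degree_indicatorVec]
      exact_mod_cast (by omega : (indicatorVec C).degree = n)
    obtain ⟨m, ⟨hm1, hm2⟩, hm⟩ := ih ⟨ht, by omega⟩
    obtain ⟨α, hα⟩ := exists_coverVec_eq hbip hmin
    refine ⟨m + Finsupp.single α 1, ⟨?_, by simp [hm2]⟩, ?_⟩
    -- The head is the new top element: if `i` lies in some `β` of the tail, then `c(x_i) ≥ 1`, so
    -- `x_i` lies in the head.
    · refine (hm1.insert (a := α) fun β hβ _ => Or.inr ?_).mono ?_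
      · intro i hi
        have h1 : 1 ≤ coverSum G m (Sum.inl i) := by
          rw [coverSum_inl]
          exact (Nat.one_le_iff_ne_zero.mpr (Finsupp.mem_support_iff.mp hβ)).trans
            (Finset.single_le_sum (f := m) (fun _ _ => Nat.zero_le _)
              (Finset.mem_filter.mpr ⟨hβ, hi⟩))
        have h2 : 1 ≤ indicatorVec C (Sum.inl i) := by
          have h3 : 1 ≤ c (Sum.inl i) := by
            rw [hm, Finsupp.tsub_apply] at h1
            omega
          rw [indicatorVec_apply, if_pos (show Sum.inl i ∈ C from h3)]
        rw [← hα, coverVec_inl] at h2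
        by_contra h
        rw [if_neg h] at h2
        omega
      · intro β hβ
        have := Finsupp.support_add hβ
        rw [Finset.mem_union] at this
        rcases this with h | h
        · exact Set.mem_insert_of_mem _ h
        · exact Set.mem_insert_iff.mpr (Or.inl (by
            simpa using Finsupp.support_single_subset h))
    · rw [map_add, hm, coverSum_single, one_smul, hα, hsum]

theorem exists_greatest_of_isChain {P : Type*} [PartialOrder P] {s : Finset P}
    (hs : IsChain (· ≤ ·) (s : Set P)) (hne : s.Nonempty) : ∃ α ∈ s, ∀ β ∈ s, β ≤ α := by
  obtain ⟨α, hα⟩ := s.exists_maximal hne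
  exact ⟨α, hα.1, fun β hβ => (hs.total hβ hα.1).elim id fun h => hα.2 hβ h⟩

/-- The greatest element of a nonempty multichain is the `x`-support of its sum. It can be read off
and cancelled, and induction finishes. -/
theorem coverSum_injOn (k : ℕ) :
    Set.InjOn (coverSum G) (multichains (coverLattice G) k) := by
  classical
  induction k with
  | zero =>
    rintro m ⟨-, hm⟩ m' ⟨-, hm'⟩ -
    rw [Finsupp.degree_eq_zero_iff] at hm hm'
    rw [hm, hm']
  | succ k ih =>
    have key : ∀ m ∈ multichains (coverLattice G) (k + 1), ∃ α : coverLattice G,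
        (∀ i, i ∈ α.1 ↔ coverSum G m (Sum.inl i) ≠ 0) ∧
        ∃ m' ∈ multichains (coverLattice G) k, m = m' + Finsupp.single α 1 := by
      rintro m ⟨hm1, hm2⟩
      have hne : m.support.Nonempty := by
        rw [Finsupp.support_nonempty_iff]
        rintro rfl
        simp at hm2
      obtain ⟨α, hα, hmax⟩ := exists_greatest_of_isChain hm1 hne
      have hsub : m - Finsupp.single α 1 + Finsupp.single α 1 = m := by
        refine tsub_add_cancel_of_le (Finsupp.single_le_iff.mpr ?_)
        exact Nat.one_le_iff_ne_zero.mpr (Finsupp.mem_support_iff.mp hα)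
      refine ⟨α, fun i => ?_, m - Finsupp.single α 1, ⟨?_, ?_⟩, hsub.symm⟩
      · rw [coverSum_inl]
        constructor
        · intro hi h
          exact Finsupp.mem_support_iff.mp hα
            (Finset.sum_eq_zero_iff.mp h α (Finset.mem_filter.mpr ⟨hα, hi⟩))
        · intro h
          obtain ⟨β, hβ, -⟩ := Finset.exists_ne_zero_of_sum_ne_zero h
          rw [Finset.mem_filter] at hβ
          exact hmax β hβ.1 hβ.2
      · refine hm1.mono fun β hβ => ?_
        exact Finsupp.support_mono tsub_le_self hβ
      · rw [← hsub, map_add, Finsupp.degree_single] at hm2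
        omega
    intro m hm m' hm' h
    obtain ⟨α, hα, l, hl, rfl⟩ := key m hm
    obtain ⟨α', hα', l', hl', rfl⟩ := key m' hm'
    have : α = α' := by
      apply Subtype.ext
      ext i
      rw [hα, hα', h]
    subst this
    rw [map_add, map_add] at h
    rw [ih hl hl' (add_right_cancel h)]

/-- The elements of a multichain are level sets of the sum of the corresponding covers. -/
theorem exists_forall_le_coverSum_iff {m : coverLattice G →₀ ℕ}
    (hm : IsChain (· ≤ ·) (m.support : Set (coverLattice G)))
    {γ : coverLattice G} (hγ : γ ∈ m.support) :
    ∃ j, ∀ i, j ≤ coverSum G m (Sum.inl i) ↔ i ∈ γ.1 := by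
  classical
  -- The threshold is the total multiplicity from `γ` upwards. All of it counts at `i ∈ γ`; at `i ∉
  -- γ` only elements strictly above `γ` can count, and the multiplicity of `γ` is lost.
  refine ⟨∑ δ ∈ m.support with γ ≤ δ, m δ, fun i => ?_⟩
  rw [coverSum_inl]
  constructor
  · intro h
    by_contra hi
    refine h.not_gt (Finset.sum_lt_sum_of_subset (i := γ) ?_ ?_ ?_ ?_ fun _ _ _ => Nat.zero_le _)
    · intro δ hδ
      rw [Finset.mem_filter] at hδ ⊢
      refine ⟨hδ.1, (hm.total hδ.1 hγ).resolve_left fun hle => hi (hle hδ.2)⟩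
    · simp [Finsupp.mem_support_iff.mp hγ]
    · simp [hi]
    · exact Nat.pos_of_ne_zero (Finsupp.mem_support_iff.mp hγ)
  · intro hi
    refine Finset.sum_le_sum_of_subset fun δ hδ => ?_
    rw [Finset.mem_filter] at hδ ⊢
    exact ⟨hδ.1, hδ.2 hi⟩

/-- Adding an element `β` to a maximal chain `s` gives a multiset whose sum of covers is also
the one of a multichain supported on `s`. -/
theorem exists_coverSum_single_add_eq
    (hbip : G.IsBipartiteWith (Set.range Sum.inl) (Set.range Sum.inr))
    (hiso : NoIsolatedVertices G) (hunm : IsUnmixed G) {s : Finset (coverLattice G)}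
    (hs : IsMaxChain (· ≤ ·) (s : Set (coverLattice G))) (β : coverLattice G) :
    ∃ e m : coverLattice G →₀ ℕ, e.support ⊆ s ∧ m.support ⊆ s ∧
      m.degree = e.degree + 1 ∧ coverSum G (e + Finsupp.single β 1) = coverSum G m := by
  classical
  -- Multiplicity one everywhere on `s` makes each element of `s` a level set of the sum of `e`.
  let e : coverLattice G →₀ ℕ := Finsupp.indicator s fun _ _ => 1
  have he : ∀ α ∈ s, e α = 1 := fun α hα => by simp [e, hα]
  have hes : e.support = s := by
    ext α
    simp [e, Finsupp.indicator_apply]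
  obtain ⟨m, ⟨hm1, hm2⟩, hm⟩ := exists_multichain_coverSum_eq hbip hiso hunm
    (coverSum_mem hbip hiso hunm (e + Finsupp.single β 1))
  refine ⟨e, m, hes.subset, fun γ hγ => ?_, by simpa using hm2, hm.symm⟩
  obtain ⟨j, hj⟩ := exists_forall_le_coverSum_iff hm1 hγ
  have hlev : ∀ i, coverSum G m (Sum.inl i) =
      coverSum G e (Sum.inl i) + coverVec β (Sum.inl i) := by
    intro i
    rw [hm, map_add, coverSum_single, one_smul, Finsupp.add_apply]
  have hβ : ∀ i, coverVec β (Sum.inl i) ≤ 1 := by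
    intro i
    rw [coverVec_inl]
    split_ifs <;> simp
  -- Adding `β` changes each `x`-coordinate by at most 1, so a level set of the new sum is
  -- comparable with every level set of the old one. Maximality of `s` then puts `γ` into `s`.
  have hcomp : ∀ α ∈ s, γ ≤ α ∨ α ≤ γ := by
    intro α hα
    obtain ⟨p, hp⟩ := exists_forall_le_coverSum_iff (hes ▸ hs.1) (hes.symm ▸ hα : α ∈ e.support)
    rcases le_or_gt j p with h | h
    · right
      intro i hi
      refine (hj i).mp ?_
      have := (hp i).mpr hi
      rw [hlev]
      omega
    · left
      intro i hi
      refine (hp i).mp ?_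
      have h1 := (hj i).mpr hi
      have h2 := hβ i
      rw [hlev] at h1
      omega
  have := hs.2 (hs.1.insert (a := γ) fun α hα _ => hcomp α hα) (Set.subset_insert _ _)
  rw [← Finset.mem_coe, this]
  exact Set.mem_insert _ _

end Multichains

/-! ## The basic cover algebra of an unmixed bipartite graph -/

section BasicCoverAlgebra

open Polynomial

/-- The monomial `x^c t^k`. -/
noncomputable abbrev coverMonomial {V : Type*} (K : Type*) [Field K] (k : ℕ) (c : V →₀ ℕ) :
    (MvPolynomial V K)[X] :=
  Polynomial.monomial k (MvPolynomial.monomial c (1 : K))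

section General

variable {V : Type*} {K : Type*} [Field K] {G : SimpleGraph V}

theorem coverMonomial_mul (k l : ℕ) (c d : V →₀ ℕ) :
    coverMonomial K k c * coverMonomial K l d = coverMonomial K (k + l) (c + d) := by
  simp [coverMonomial, Polynomial.monomial_mul_monomial]

theorem coverMonomial_mem {k : ℕ} {c : V →₀ ℕ} (hc : IsKVertexCover G k c) :
    coverMonomial K k c ∈ vertexCoverAlgebra K G :=
  Algebra.subset_adjoin ⟨k, c, hc, rfl⟩

/-- The cover monomials are closed under products and, for `k = 0`, include all monomials of `R`.
Hence their `K`-span is already the whole algebra. -/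
theorem vertexCoverAlgebra_induction {p : (MvPolynomial V K)[X] → Prop}
    (monomial : ∀ k c, IsKVertexCover G k c → p (coverMonomial K k c)) (zero : p 0)
    (add : ∀ f g, p f → p g → p (f + g)) (smul : ∀ (a : K) f, p f → p (a • f))
    {f : (MvPolynomial V K)[X]} (hf : f ∈ vertexCoverAlgebra K G) : p f := by
  suffices h : f ∈ Submodule.span K
      {f | ∃ (k : ℕ) (c : V →₀ ℕ), IsKVertexCover G k c ∧ f = coverMonomial K k c} by
    clear hf
    induction h using Submodule.span_induction with
    | mem f hf => obtain ⟨k, c, hc, rfl⟩ := hf; exact monomial k c hc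
    | zero => exact zero
    | add f g _ _ hf hg => exact add f g hf hg
    | smul a f _ hf => exact smul a f hf
  unfold vertexCoverAlgebra at hf
  induction hf using Algebra.adjoin_induction with
  | mem f hf => exact Submodule.subset_span hf
  | algebraMap r =>
    rw [r.as_sum, map_sum]
    refine sum_mem fun c _ => ?_
    have : algebraMap (MvPolynomial V K) (MvPolynomial V K)[X]
        (MvPolynomial.monomial c (r.coeff c)) = r.coeff c • coverMonomial K 0 c := by
      rw [coverMonomial, smul_monomial]
      simp [MvPolynomial.smul_monomial]
    rw [this]
    exact Submodule.smul_mem _ _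
      (Submodule.subset_span ⟨0, c, isKVertexCover_zero c, rfl⟩)
  | add f g _ _ hf hg => exact add_mem hf hg
  | mul f g _ _ hf hg =>
    have := Submodule.mul_mem_mul hf hg
    rw [Submodule.span_mul_span] at this
    refine Submodule.span_mono ?_ this
    rintro _ ⟨_, ⟨k, c, hc, rfl⟩, _, ⟨l, d, hd, rfl⟩, rfl⟩
    exact ⟨k + l, c + d, hc.add hd, coverMonomial_mul k l c d⟩

/-- The projection of `K[x][t]` to the span of the monomials `x^c t^k` with `|c| = k n`. -/
noncomputable def minimalPart (n : ℕ) :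
    (MvPolynomial V K)[X] →ₗ[K] (MvPolynomial V K)[X] :=
  Polynomial.lsum fun k =>
    (Polynomial.monomial k).restrictScalars K ∘ₗ MvPolynomial.homogeneousComponent (k * n)

theorem minimalPart_monomial (n k : ℕ) (a : MvPolynomial V K) :
    minimalPart n (Polynomial.monomial k a) =
      Polynomial.monomial k (MvPolynomial.homogeneousComponent (k * n) a) :=
  Polynomial.sum_monomial_index _ _ (by simp)

theorem minimalPart_coverMonomial (n k : ℕ) (c : V →₀ ℕ) :
    minimalPart n (coverMonomial K k c) =
      if c.degree = k * n then coverMonomial K k c else 0 := by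
  rw [minimalPart_monomial, MvPolynomial.homogeneousComponent_of_mem
    (MvPolynomial.isHomogeneous_monomial 1 rfl)]
  simp only [eq_comm]
  split_ifs <;> simp

theorem linearIndependent_coverMonomial (V K : Type*) [Field K] :
    LinearIndependent K (fun p : ℕ × (V →₀ ℕ) => coverMonomial K p.1 p.2) := by
  classical
  rw [linearIndependent_iff']
  intro s g hg p hp
  have h := congrArg (fun f : (MvPolynomial V K)[X] => (f.coeff p.1).coeff p.2) hg
  simp only [Polynomial.finsetSum_coeff, MvPolynomial.coeff_sum, Polynomial.coeff_smul,
    MvPolynomial.coeff_smul, coverMonomial, Polynomial.coeff_monomial] at h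
  rw [Finset.sum_eq_single p] at h
  · simpa [MvPolynomial.coeff_monomial] using h
  · rintro ⟨k, c⟩ - hne
    by_cases hk : k = p.1
    · have hc : c ≠ p.2 := fun hc => hne (Prod.ext hk hc)
      simp [hk, MvPolynomial.coeff_monomial, hc]
    · simp [hk]
  · exact fun h => absurd hp h

end General

end BasicCoverAlgebra

/-! ### Embedding the basic cover algebra as the part of minimal degree -/

section Embedding

open Polynomial

variable {V : Type*} {K : Type*} [Field K] {G : SimpleGraph V} {n : ℕ}

/-- The excess `|c| - k * n` is additive and, by `hdeg`, nonnegative on `A(G)`. A product has excess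
zero only if both factors do. -/
theorem minimalPart_mul (hdeg : ∀ k c, IsKVertexCover G k c → k * n ≤ c.degree)
    {f g : (MvPolynomial V K)[X]} (hf : f ∈ vertexCoverAlgebra K G)
    (hg : g ∈ vertexCoverAlgebra K G) :
    minimalPart n (f * g) = minimalPart n f * minimalPart n g := by
  refine vertexCoverAlgebra_induction
    (p := fun f => minimalPart n (f * g) = minimalPart n f * minimalPart n g)
    (fun k c hc => ?_) (by simp) (fun f f' h h' => by simp [add_mul, h, h'])
    (fun a f h => by simp [h]) hf
  refine vertexCoverAlgebra_induction
    (p := fun g => minimalPart n (coverMonomial K k c * g) =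
      minimalPart n (coverMonomial K k c) * minimalPart n g)
    (fun l d hd => ?_) (by simp) (fun f f' h h' => by simp [mul_add, h, h'])
    (fun a f h => by simp [h]) hg
  have h1 := hdeg k c hc
  have h2 := hdeg l d hd
  rw [coverMonomial_mul]
  simp only [minimalPart_coverMonomial, map_add, add_mul]
  by_cases h3 : c.degree = k * n
  · by_cases h4 : d.degree = l * n
    · rw [if_pos h3, if_pos h4, if_pos (by omega), coverMonomial_mul]
    · rw [if_neg h4, if_neg (by omega), mul_zero]
  · rw [if_neg h3, if_neg (by omega), zero_mul]

/-- The projection to the minimal part, on the vertex cover algebra. -/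
noncomputable def minimalPartHom (K : Type*) [Field K]
    (hdeg : ∀ k c, IsKVertexCover G k c → k * n ≤ c.degree) :
    vertexCoverAlgebra K G →ₐ[K] (MvPolynomial V K)[X] :=
  AlgHom.ofLinearMap
    (minimalPart n ∘ₗ (vertexCoverAlgebra K G).val.toLinearMap.restrictScalars K)
    (by
      have := minimalPart_coverMonomial (K := K) n 0 (0 : V →₀ ℕ)
      simpa [coverMonomial] using this)
    (fun f g => minimalPart_mul hdeg f.2 g.2)

theorem minimalPartHom_apply (hdeg : ∀ k c, IsKVertexCover G k c → k * n ≤ c.degree)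
    (f : vertexCoverAlgebra K G) : minimalPartHom K hdeg f = minimalPart n (f : _) := rfl

theorem minimalPartHom_eq_zero (hdeg : ∀ k c, IsKVertexCover G k c → k * n ≤ c.degree)
    {f : vertexCoverAlgebra K G}
    (hf : f ∈ (maximalGradedIdeal V K).map
      (algebraMap (MvPolynomial V K) (vertexCoverAlgebra K G))) :
    minimalPartHom K hdeg f = 0 := by
  rw [← RingHom.mem_ker]
  refine (Ideal.map_le_iff_le_comap.mpr ?_ :
    (maximalGradedIdeal V K).map (algebraMap _ (vertexCoverAlgebra K G)) ≤ _) hf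
  rw [maximalGradedIdeal, Ideal.span_le]
  rintro _ ⟨v, rfl⟩
  rw [SetLike.mem_coe, Ideal.mem_comap, RingHom.mem_ker, minimalPartHom_apply]
  have : ((algebraMap (MvPolynomial V K) (vertexCoverAlgebra K G) (MvPolynomial.X v) :
      vertexCoverAlgebra K G) : (MvPolynomial V K)[X]) =
      coverMonomial K 0 (Finsupp.single v 1) := rfl
  rw [this, minimalPart_coverMonomial, if_neg (by simp)]

/-- The embedding of the basic cover algebra into `K[x][t]` given by the minimal part. -/
noncomputable def fiberEmbedding (K : Type*) [Field K]
    (hdeg : ∀ k c, IsKVertexCover G k c → k * n ≤ c.degree) :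
    BasicCoverAlgebra K G →ₐ[K] (MvPolynomial V K)[X] :=
  Ideal.Quotient.liftₐ _ (minimalPartHom K hdeg) fun _ hf => minimalPartHom_eq_zero hdeg hf

theorem fiberEmbedding_mk (hdeg : ∀ k c, IsKVertexCover G k c → k * n ≤ c.degree)
    (f : vertexCoverAlgebra K G) :
    fiberEmbedding K hdeg (Fiber.mk K _ _ f) = minimalPart n (f : _) := rfl

theorem coverMonomial_mem_map {k : ℕ} {d : V →₀ ℕ} (hd : IsKVertexCover G k d) (v : V) :
    ∃ h : coverMonomial K k (d + Finsupp.single v 1) ∈ vertexCoverAlgebra K G,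
      (⟨_, h⟩ : vertexCoverAlgebra K G) ∈ (maximalGradedIdeal V K).map
        (algebraMap (MvPolynomial V K) (vertexCoverAlgebra K G)) := by
  refine ⟨coverMonomial_mem (hd.add (isKVertexCover_zero (Finsupp.single v 1))), ?_⟩
  have h1 : algebraMap (MvPolynomial V K) (vertexCoverAlgebra K G) (MvPolynomial.X v) ∈
      (maximalGradedIdeal V K).map
        (algebraMap (MvPolynomial V K) (vertexCoverAlgebra K G)) :=
    Ideal.mem_map_of_mem _ (Ideal.subset_span ⟨v, rfl⟩)
  convert Ideal.mul_mem_left _ ⟨coverMonomial K k d, coverMonomial_mem hd⟩ h1 using 1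
  apply Subtype.ext
  exact (coverMonomial_mul k 0 d (Finsupp.single v 1)).symm

/-- It suffices that `f - minimalPart n f` lies in `𝔪 A(G)`. On a monomial of positive excess,
`hsub` splits off a variable. -/
theorem fiberEmbedding_injective (hdeg : ∀ k c, IsKVertexCover G k c → k * n ≤ c.degree)
    (hsub : ∀ k c, IsKVertexCover G k c → k * n < c.degree →
      ∃ d v, IsKVertexCover G k d ∧ c = d + Finsupp.single v 1) :
    Function.Injective (fiberEmbedding K hdeg) := by
  rw [injective_iff_map_eq_zero]
  intro b hb
  obtain ⟨f, rfl⟩ := Ideal.Quotient.mk_surjective b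
  change fiberEmbedding K hdeg (Fiber.mk K _ _ f) = 0 at hb
  rw [fiberEmbedding_mk] at hb
  suffices h : ∃ h : (f : (MvPolynomial V K)[X]) - minimalPart n (f : (MvPolynomial V K)[X]) ∈
      vertexCoverAlgebra K G, (⟨_, h⟩ : vertexCoverAlgebra K G) ∈
        (maximalGradedIdeal V K).map
          (algebraMap (MvPolynomial V K) (vertexCoverAlgebra K G)) by
    obtain ⟨h, h'⟩ := h
    refine Ideal.Quotient.eq_zero_iff_mem.mpr ?_
    convert h'
    rw [hb, sub_zero]
  refine vertexCoverAlgebra_induction (p := fun f => ∃ h : f - minimalPart n f ∈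
      vertexCoverAlgebra K G, (⟨_, h⟩ : vertexCoverAlgebra K G) ∈
        (maximalGradedIdeal V K).map
          (algebraMap (MvPolynomial V K) (vertexCoverAlgebra K G))) ?_ ?_ ?_ ?_ f.2
  · intro k c hc
    by_cases h : c.degree = k * n
    · rw [minimalPart_coverMonomial, if_pos h, sub_self]
      exact ⟨zero_mem _, zero_mem _⟩
    · rw [minimalPart_coverMonomial, if_neg h, sub_zero]
      obtain ⟨d, v, hd, rfl⟩ := hsub k c hc (lt_of_le_of_ne (hdeg k c hc) (Ne.symm h))
      exact coverMonomial_mem_map hd v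
  · rw [map_zero, sub_zero]
    exact ⟨zero_mem _, zero_mem _⟩
  · rintro f g ⟨hf, hf'⟩ ⟨hg, hg'⟩
    rw [map_add, add_sub_add_comm]
    have h := Ideal.add_mem _ hf' hg'
    exact ⟨add_mem hf hg, h⟩
  · rintro a f ⟨hf, hf'⟩
    have h : a • f - minimalPart n (a • f) =
        algebraMap (MvPolynomial V K) (MvPolynomial V K)[X] (MvPolynomial.C a) *
          (f - minimalPart n f) := by
      rw [map_smul, ← smul_sub, Algebra.smul_def]
      rfl
    rw [h]
    have h' := Ideal.mul_mem_left _
      (algebraMap (MvPolynomial V K) (vertexCoverAlgebra K G) (MvPolynomial.C a)) hf'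
    have h'' := mul_mem (Subalgebra.algebraMap_mem (vertexCoverAlgebra K G)
      (MvPolynomial.C a)) hf
    exact ⟨h'', h'⟩

theorem map_fiberEmbedding_component (hdeg : ∀ k c, IsKVertexCover G k c → k * n ≤ c.degree)
    (k : ℕ) :
    (basicCoverComponent K G k).map (fiberEmbedding K hdeg).toLinearMap =
      Submodule.span K (coverMonomial K k '' {c | IsKVertexCover G k c ∧ c.degree = k * n}) := by
  apply le_antisymm
  · rintro _ ⟨_, ⟨a, ⟨r, hr⟩, rfl⟩, rfl⟩
    change fiberEmbedding K hdeg (Fiber.mk K _ _ a) ∈ _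
    rw [fiberEmbedding_mk]
    -- Being of the form `r t^k` is not preserved in the induction, so the claim concerns the
    -- `t^k`-coefficient of an arbitrary element of `A(G)`.
    have key : Polynomial.monomial k ((minimalPart n (a : (MvPolynomial V K)[X])).coeff k) ∈
        Submodule.span K
          (coverMonomial K k '' {c | IsKVertexCover G k c ∧ c.degree = k * n}) := by
      refine vertexCoverAlgebra_induction (p := fun f =>
        Polynomial.monomial k ((minimalPart n f).coeff k) ∈ Submodule.span K
          (coverMonomial K k '' {c | IsKVertexCover G k c ∧ c.degree = k * n})) ?_ ?_ ?_ ?_ a.2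
      · intro l c hc
        rw [minimalPart_coverMonomial]
        split_ifs with h
        · rw [coverMonomial, Polynomial.coeff_monomial]
          split_ifs with hl
          · subst hl
            exact Submodule.subset_span ⟨c, ⟨hc, h⟩, rfl⟩
          · simp
        · simp
      · simp
      · intro f g hf hg
        rw [map_add, Polynomial.coeff_add, map_add]
        exact add_mem hf hg
      · intro a f hf
        rw [map_smul, Polynomial.coeff_smul, ← Polynomial.smul_monomial]
        exact Submodule.smul_mem _ _ hf
    rw [hr, minimalPart_monomial] at key ⊢
    rwa [Polynomial.coeff_monomial_same] at key
  · rw [Submodule.span_le]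
    rintro _ ⟨c, ⟨hc, hd⟩, rfl⟩
    refine ⟨Fiber.mk K _ _ ⟨coverMonomial K k c, coverMonomial_mem hc⟩,
      ⟨_, ⟨_, rfl⟩, rfl⟩, ?_⟩
    change fiberEmbedding K hdeg (Fiber.mk K _ _ _) = _
    rw [fiberEmbedding_mk, minimalPart_coverMonomial, if_pos hd]

theorem linearIndependent_coverMonomial_image (K : Type*) [Field K] (k : ℕ)
    (s : Set (V →₀ ℕ)) :
    LinearIndependent K (fun c : s => coverMonomial K k c.1) :=
  (linearIndependent_coverMonomial V K).comp (fun c : s => (k, c.1))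
    fun _ _ h => Subtype.ext (congrArg Prod.snd h)

theorem finite_and_finrank_component (hdeg : ∀ k c, IsKVertexCover G k c → k * n ≤ c.degree)
    (hsub : ∀ k c, IsKVertexCover G k c → k * n < c.degree →
      ∃ d v, IsKVertexCover G k d ∧ c = d + Finsupp.single v 1)
    {k : ℕ} (hfin : {c | IsKVertexCover G k c ∧ c.degree = k * n}.Finite) :
    Module.Finite K (basicCoverComponent K G k) ∧
      Module.finrank K (basicCoverComponent K G k) =
        {c | IsKVertexCover G k c ∧ c.degree = k * n}.ncard := by
  set s := {c | IsKVertexCover G k c ∧ c.degree = k * n}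
  have e := Submodule.equivMapOfInjective (fiberEmbedding K hdeg).toLinearMap
    (fiberEmbedding_injective hdeg hsub) (basicCoverComponent K G k)
  rw [map_fiberEmbedding_component] at e
  have := FiniteDimensional.span_of_finite K (hfin.image (coverMonomial K k))
  refine ⟨Module.Finite.equiv e.symm, ?_⟩
  rw [e.finrank_eq]
  have := hfin.fintype
  rw [Set.image_eq_range, finrank_span_eq_card (linearIndependent_coverMonomial_image K k s),
    ← Nat.card_eq_fintype_card, Nat.card_coe_set_eq]

end Embedding

/-! ### Generators, transcendence basis and Krull dimension -/

section Dimension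

variable {n : ℕ} {G : SimpleGraph (Fin n ⊕ Fin n)}

/-- The class in the basic cover algebra of `x^c t`, where `c` is the minimal vertex cover belonging
to an element of the lattice. -/
noncomputable def coverGen (K : Type*) [Field K] (α : coverLattice G) : BasicCoverAlgebra K G :=
  Fiber.mk K _ _ ⟨coverMonomial K 1 (coverVec α),
    coverMonomial_mem (isKVertexCover_indicatorVec.mpr α.2.choose_spec.1.1)⟩

/-- The product of the generators over a multiset of elements of the lattice. -/
noncomputable def genProd (K : Type*) [Field K] (m : coverLattice G →₀ ℕ) :
    BasicCoverAlgebra K G :=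
  m.prod fun α a => coverGen K α ^ a

theorem genProd_add (K : Type*) [Field K] (m m' : coverLattice G →₀ ℕ) :
    genProd K (m + m') = genProd K m * genProd K m' := by
  classical
  exact Finsupp.prod_add_index' (fun _ => pow_zero _) fun _ _ _ => pow_add _ _ _

theorem genProd_single (K : Type*) [Field K] (α : coverLattice G) (a : ℕ) :
    genProd K (Finsupp.single α a) = coverGen K α ^ a :=
  Finsupp.prod_single_index (pow_zero _)

theorem genProd_mem_adjoin (K : Type*) [Field K] {s : Set (coverLattice G)}
    {m : coverLattice G →₀ ℕ} (hm : (m.support : Set (coverLattice G)) ⊆ s) :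
    genProd K m ∈ Algebra.adjoin K (coverGen K '' s) :=
  prod_mem fun _ hα => pow_mem (Algebra.subset_adjoin (Set.mem_image_of_mem _ (hm hα))) _

/-- The embedding of the basic cover algebra of an unmixed bipartite graph into `K[x, y][t]`. -/
noncomputable def basicCoverEmbedding (K : Type*) [Field K]
    (hbip : G.IsBipartiteWith (Set.range Sum.inl) (Set.range Sum.inr))
    (hiso : NoIsolatedVertices G) (hunm : IsUnmixed G) :
    BasicCoverAlgebra K G →ₐ[K] Polynomial (MvPolynomial (Fin n ⊕ Fin n) K) :=
  fiberEmbedding K fun _ _ hc => hc.le_degree hbip hiso hunm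

theorem basicCoverEmbedding_injective (K : Type*) [Field K]
    (hbip : G.IsBipartiteWith (Set.range Sum.inl) (Set.range Sum.inr))
    (hiso : NoIsolatedVertices G) (hunm : IsUnmixed G) :
    Function.Injective (basicCoverEmbedding K hbip hiso hunm) :=
  fiberEmbedding_injective _ fun _ _ hc h => exists_isKVertexCover_sub_single hbip hiso hunm hc h

theorem basicCoverEmbedding_coverGen (K : Type*) [Field K]
    (hbip : G.IsBipartiteWith (Set.range Sum.inl) (Set.range Sum.inr))
    (hiso : NoIsolatedVertices G) (hunm : IsUnmixed G)
    (α : coverLattice G) :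
    basicCoverEmbedding K hbip hiso hunm (coverGen K α) = coverMonomial K 1 (coverVec α) := by
  rw [basicCoverEmbedding, coverGen, fiberEmbedding_mk, minimalPart_coverMonomial,
    if_pos (coverVec_mem hbip hiso hunm α).2]

theorem coverMonomial_pow {V : Type*} (K : Type*) [Field K] (k : ℕ) (c : V →₀ ℕ) (a : ℕ) :
    coverMonomial K k c ^ a = coverMonomial K (a * k) (a • c) := by
  simp [coverMonomial, Polynomial.monomial_pow, MvPolynomial.monomial_pow, mul_comm]

theorem basicCoverEmbedding_genProd (K : Type*) [Field K]
    (hbip : G.IsBipartiteWith (Set.range Sum.inl) (Set.range Sum.inr))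
    (hiso : NoIsolatedVertices G) (hunm : IsUnmixed G)
    (m : coverLattice G →₀ ℕ) :
    basicCoverEmbedding K hbip hiso hunm (genProd K m) =
      coverMonomial K m.degree (coverSum G m) := by
  induction m using Finsupp.induction_linear with
  | zero =>
    rw [map_zero, map_zero, genProd, Finsupp.prod_zero_index, map_one]
    rfl
  | add f g hf hg => rw [genProd_add, map_mul, hf, hg, coverMonomial_mul, map_add, map_add]
  | single α a =>
    rw [genProd_single, map_pow, basicCoverEmbedding_coverGen, coverMonomial_pow,
      Finsupp.degree_single, coverSum_single, mul_one]

theorem isDomain_basicCoverAlgebra (K : Type*) [Field K]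
    (hbip : G.IsBipartiteWith (Set.range Sum.inl) (Set.range Sum.inr))
    (hiso : NoIsolatedVertices G) (hunm : IsUnmixed G) : IsDomain (BasicCoverAlgebra K G) :=
  (basicCoverEmbedding_injective K hbip hiso hunm).isDomain
    (basicCoverEmbedding K hbip hiso hunm).toRingHom

theorem adjoin_coverGen_eq_top (K : Type*) [Field K]
    (hbip : G.IsBipartiteWith (Set.range Sum.inl) (Set.range Sum.inr))
    (hiso : NoIsolatedVertices G) (hunm : IsUnmixed G) :
    Algebra.adjoin K (coverGen K '' (Set.univ : Set (coverLattice G))) = ⊤ := by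
  rw [eq_top_iff]
  rintro b -
  obtain ⟨f, rfl⟩ := Ideal.Quotient.mk_surjective b
  suffices h : ∃ h : (f : Polynomial (MvPolynomial (Fin n ⊕ Fin n) K)) ∈ vertexCoverAlgebra K G,
      Fiber.mk K _ (maximalGradedIdeal _ K) (⟨f, h⟩ : vertexCoverAlgebra K G) ∈
        Algebra.adjoin K (coverGen K '' (Set.univ : Set (coverLattice G))) from h.2
  refine vertexCoverAlgebra_induction (p := fun f => ∃ h : f ∈ vertexCoverAlgebra K G,
      Fiber.mk K _ (maximalGradedIdeal _ K) (⟨f, h⟩ : vertexCoverAlgebra K G) ∈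
        Algebra.adjoin K (coverGen K '' (Set.univ : Set (coverLattice G)))) ?_ ?_ ?_ ?_ f.2
  · intro k c hc
    refine ⟨coverMonomial_mem hc, ?_⟩
    by_cases h : c.degree = k * n
    · obtain ⟨m, ⟨-, hm⟩, hmc⟩ := exists_multichain_coverSum_eq hbip hiso hunm ⟨hc, h⟩
      -- A cover of minimal degree is a sum of lattice covers, so its class is a product of
      -- generators. In the other case the class is zero.
      convert genProd_mem_adjoin K (m := m) (Set.subset_univ _)
      apply basicCoverEmbedding_injective K hbip hiso hunm
      rw [basicCoverEmbedding_genProd, hmc, hm, basicCoverEmbedding, fiberEmbedding_mk,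
        minimalPart_coverMonomial, if_pos h]
    · convert (Algebra.adjoin K (coverGen K '' (Set.univ : Set (coverLattice G)))).zero_mem
      apply basicCoverEmbedding_injective K hbip hiso hunm
      rw [basicCoverEmbedding, fiberEmbedding_mk, minimalPart_coverMonomial, if_neg h, map_zero]
  · exact ⟨zero_mem _, by
      have : (⟨0, zero_mem _⟩ : vertexCoverAlgebra K G) = 0 := rfl
      rw [this, map_zero]; exact zero_mem _⟩
  · rintro f g ⟨hf, hf'⟩ ⟨hg, hg'⟩
    refine ⟨add_mem hf hg, ?_⟩
    have := add_mem hf' hg'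
    rwa [← map_add] at this
  · rintro a f ⟨hf, hf'⟩
    have h : a • (⟨f, hf⟩ : vertexCoverAlgebra K G) = a • f := rfl
    refine ⟨h ▸ (a • (⟨f, hf⟩ : vertexCoverAlgebra K G)).2, ?_⟩
    have := Subalgebra.smul_mem _ hf' a
    rwa [← map_smul] at this

theorem finiteType_basicCoverAlgebra (K : Type*) [Field K]
    (hbip : G.IsBipartiteWith (Set.range Sum.inl) (Set.range Sum.inr))
    (hiso : NoIsolatedVertices G) (hunm : IsUnmixed G) :
    Algebra.FiniteType K (BasicCoverAlgebra K G) :=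
  ⟨⟨((Set.toFinite _).image _).toFinset, by
    rw [Set.Finite.coe_toFinset]
    exact adjoin_coverGen_eq_top K hbip hiso hunm⟩⟩

/-- Monomials in the generators of a chain correspond to multichains supported on it. By
`coverSum_injOn` they map to distinct, hence linearly independent, monomials. -/
theorem algebraicIndependent_coverGen (K : Type*) [Field K]
    (hbip : G.IsBipartiteWith (Set.range Sum.inl) (Set.range Sum.inr))
    (hiso : NoIsolatedVertices G) (hunm : IsUnmixed G)
    {s : Finset (coverLattice G)}
    (hs : IsChain (· ≤ ·) (s : Set (coverLattice G))) :
    AlgebraicIndependent K (fun α : s => coverGen K α.1) := by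
  classical
  rw [algebraicIndependent_iff]
  intro p hp
  let φ : (s →₀ ℕ) → (coverLattice G →₀ ℕ) := Finsupp.mapDomain Subtype.val
  have hφ : ∀ m, IsChain (· ≤ ·) ((φ m).support : Set (coverLattice G)) := fun m =>
    hs.mono fun α hα => by
      have := Finsupp.mapDomain_support hα
      rw [Finset.mem_image] at this
      obtain ⟨β, -, rfl⟩ := this
      exact β.2
  have hli : LinearIndependent K
      (fun m : s →₀ ℕ => coverMonomial K (φ m).degree (coverSum G (φ m))) := by
    refine (linearIndependent_coverMonomial (Fin n ⊕ Fin n) K).comp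
      (fun m : s →₀ ℕ => ((φ m).degree, coverSum G (φ m))) fun m m' h => ?_
    rw [Prod.mk.injEq] at h
    exact Finsupp.mapDomain_injective Subtype.val_injective
      (coverSum_injOn _ ⟨hφ m, rfl⟩ ⟨hφ m', h.1.symm⟩ h.2)
  have h := congrArg (basicCoverEmbedding K hbip hiso hunm) hp
  rw [MvPolynomial.aeval_def, MvPolynomial.eval₂_eq, map_sum, map_zero] at h
  have hterm : ∀ m ∈ p.support, basicCoverEmbedding K hbip hiso hunm
      (algebraMap K _ (p.coeff m) * ∏ i ∈ m.support, coverGen K i.1 ^ m i) =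
        p.coeff m • coverMonomial K (φ m).degree (coverSum G (φ m)) := by
    intro m _
    rw [← Algebra.smul_def, map_smul, ← basicCoverEmbedding_genProd K hbip hiso hunm]
    congr 2
    exact (Finsupp.prod_mapDomain_index (fun _ => pow_zero _) fun _ _ _ => pow_add _ _ _).symm
  rw [Finset.sum_congr rfl hterm] at h
  ext m
  rw [MvPolynomial.coeff_zero]
  by_contra hm
  exact hm (linearIndependent_iff'.mp hli p.support _ h m (MvPolynomial.mem_support_iff.mpr hm))

theorem isTranscendenceBasis_coverGen (K : Type*) [Field K]
    (hbip : G.IsBipartiteWith (Set.range Sum.inl) (Set.range Sum.inr))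
    (hiso : NoIsolatedVertices G) (hunm : IsUnmixed G)
    {s : Finset (coverLattice G)}
    (hs : IsMaxChain (· ≤ ·) (s : Set (coverLattice G))) :
    IsTranscendenceBasis K (fun α : s => coverGen K α.1) := by
  have := isDomain_basicCoverAlgebra K hbip hiso hunm
  have hind := algebraicIndependent_coverGen K hbip hiso hunm hs.1
  rw [hind.isTranscendenceBasis_iff_isAlgebraic]
  have hrange : Set.range (fun α : s => coverGen K α.1) = coverGen K '' (s : Set _) := by
    rw [Set.image_eq_range]
    rfl
  rw [hrange]
  set B := Algebra.adjoin K (coverGen K '' (s : Set (coverLattice G)))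
  have hB : ∀ b ∈ B, IsAlgebraic B b := fun b hb => isAlgebraic_algebraMap (⟨b, hb⟩ : B)
  have hgen : ∀ β : coverLattice G, IsAlgebraic B (coverGen K β) := by
    intro β
    obtain ⟨e, m, he, hm, hdeg, hsum⟩ := exists_coverSum_single_add_eq hbip hiso hunm hs β
    have hmul : genProd K e * coverGen K β = genProd K m := by
      apply basicCoverEmbedding_injective K hbip hiso hunm
      rw [← pow_one (coverGen K β), ← genProd_single, ← genProd_add,
        basicCoverEmbedding_genProd, basicCoverEmbedding_genProd, hsum, hdeg, map_add,
        Finsupp.degree_single]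
    have hne : genProd K e ≠ 0 := by
      intro h
      have := basicCoverEmbedding_genProd K hbip hiso hunm e
      rw [h, map_zero] at this
      exact (linearIndependent_coverMonomial (Fin n ⊕ Fin n) K).ne_zero (_, _) this.symm
    -- In the domain, `coverGen K β` is the quotient of two elements of `B`.
    refine IsAlgebraic.of_mul (mem_nonZeroDivisors_of_ne_zero hne)
      (hB _ (genProd_mem_adjoin K (Finset.coe_subset.mpr he))) ?_
    rw [hmul]
    exact hB _ (genProd_mem_adjoin K (Finset.coe_subset.mpr hm))
  refine ⟨fun b => ?_⟩
  have hb : b ∈ Algebra.adjoin K (coverGen K '' (Set.univ : Set (coverLattice G))) := by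
    rw [adjoin_coverGen_eq_top K hbip hiso hunm]
    trivial
  have hle : Algebra.adjoin K (coverGen K '' (Set.univ : Set (coverLattice G))) ≤
      (Subalgebra.algebraicClosure B (BasicCoverAlgebra K G)).restrictScalars K := by
    rw [Algebra.adjoin_le_iff]
    rintro _ ⟨β, -, rfl⟩
    exact hgen β
  exact hle hb

theorem ringKrullDim_basicCoverAlgebra (K : Type*) [Field K]
    (hbip : G.IsBipartiteWith (Set.range Sum.inl) (Set.range Sum.inr))
    (hiso : NoIsolatedVertices G) (hunm : IsUnmixed G)
    {s : Finset (coverLattice G)}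
    (hs : IsMaxChain (· ≤ ·) (s : Set (coverLattice G))) :
    ringKrullDim (BasicCoverAlgebra K G) = (s.card : ℕ) := by
  have := isDomain_basicCoverAlgebra K hbip hiso hunm
  have := finiteType_basicCoverAlgebra K hbip hiso hunm
  rw [(isTranscendenceBasis_coverGen K hbip hiso hunm hs).ringKrullDim_eq]
  simp

end Dimension

/-! ## The generating function of multichains -/

section GeneratingFunction

open PowerSeries

/-- Support exactly `s` means that each element of `s` has an independent multiplicity at least 1,
contributing a factor `z + z^2 + ⋯ = z / (1 - z)`. -/
theorem mk_card_support_eq {P : Type*} [DecidableEq P] (s : Finset P) :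
    (PowerSeries.mk fun k => (((s.finsuppAntidiag k).filter (·.support = s)).card : ℤ)) =
      (PowerSeries.mk fun k => if k = 0 then (0 : ℤ) else 1) ^ s.card := by
  rw [← Finset.prod_const]
  ext k
  rw [PowerSeries.coeff_prod, PowerSeries.coeff_mk, Finset.card_filter, Nat.cast_sum]
  refine Finset.sum_congr rfl fun l hl => ?_
  have hl' := (Finset.mem_finsuppAntidiag.mp hl).2
  simp only [PowerSeries.coeff_mk]
  split_ifs with h
  · rw [Finset.prod_congr rfl fun i hi => if_neg (Finsupp.mem_support_iff.mp (h ▸ hi))]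
    simp
  · obtain ⟨i, hi, hi'⟩ := Finset.not_subset.mp fun h' => h (hl'.antisymm h')
    rw [Nat.cast_zero, eq_comm]
    refine Finset.prod_eq_zero hi ?_
    exact if_pos (Finsupp.notMem_support_iff.mp hi')

theorem one_sub_X_mul_mk_ite :
    (1 - X : PowerSeries ℤ) * (PowerSeries.mk fun k => if k = 0 then (0 : ℤ) else 1) = X := by
  ext k
  rw [sub_mul, one_mul, map_sub]
  rcases k with _ | _ | k
  · simp
  · simp [PowerSeries.coeff_succ_X_mul]
  · simp [PowerSeries.coeff_succ_X_mul, PowerSeries.coeff_X]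

open Classical in
theorem ncard_multichains {P : Type*} [PartialOrder P] [Fintype P] (k : ℕ) :
    (multichains P k).ncard =
      ∑ s ∈ Finset.univ.filter fun s : Finset P => IsChain (· ≤ ·) (s : Set P),
      ((s.finsuppAntidiag k).filter (·.support = s)).card := by
  have h : multichains P k = (((Finset.univ : Finset P).finsuppAntidiag k).filter
      fun m => IsChain (· ≤ ·) (m.support : Set P) : Finset (P →₀ ℕ)) := by
    ext m
    simp [multichains, Finsupp.degree_eq_sum, and_comm]
  rw [h, Set.ncard_coe_finset, Finset.card_eq_sum_card_fiberwise (f := Finsupp.support)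
    (t := {s : Finset P | IsChain (· ≤ ·) (s : Set P)})]
  · refine Finset.sum_congr rfl fun s hs => congrArg Finset.card ?_
    rw [Finset.mem_filter] at hs
    ext m
    simp only [Finset.mem_filter, Finset.mem_finsuppAntidiag']
    constructor
    · rintro ⟨⟨⟨h1, -⟩, -⟩, rfl⟩
      exact ⟨⟨h1, subset_rfl⟩, rfl⟩
    · rintro ⟨⟨h1, -⟩, rfl⟩
      exact ⟨⟨⟨h1, Finset.subset_univ _⟩, hs.2⟩, rfl⟩
  · intro m hm
    simpa using (Finset.mem_filter.mp hm).2

theorem card_le_dimSucc {P : Type*} [PartialOrder P] [Finite P] {s : Finset P}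
    (hs : IsChain (· ≤ ·) (s : Set P)) : s.card ≤ dimSucc (orderComplex P) := by
  rcases s.eq_empty_or_nonempty with rfl | hne
  · simp
  · have := Fintype.ofFinite P
    refine le_csSup ⟨Fintype.card P, ?_⟩ ⟨s, ⟨hne, hs⟩, rfl⟩
    rintro _ ⟨t, -, rfl⟩
    exact t.card_le_univ

theorem exists_isMaxChain_card_eq_dimSucc (P : Type*) [PartialOrder P] [Finite P] [Nonempty P] :
    ∃ s : Finset P, IsMaxChain (· ≤ ·) (s : Set P) ∧ s.card = dimSucc (orderComplex P) := by
  have := Fintype.ofFinite P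
  obtain ⟨s, ⟨-, hs⟩, hcard⟩ : dimSucc (orderComplex P) ∈
      Finset.card '' (orderComplex P).faces := by
    refine Nat.sSup_mem ?_ ⟨Fintype.card P, ?_⟩
    · exact ⟨_, {Classical.arbitrary P}, (orderComplex P).singleton_mem _, rfl⟩
    · rintro _ ⟨t, -, rfl⟩
      exact t.card_le_univ
  -- A chain of largest cardinality is maximal for inclusion.
  refine ⟨s, ⟨hs, fun t ht hst => ?_⟩, hcard⟩
  lift t to Finset P using Set.toFinite t
  rw [Finset.coe_inj]
  exact Finset.eq_of_subset_of_card_le (Finset.coe_subset.mp hst)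
    (hcard ▸ card_le_dimSucc ht)

open Classical in
theorem numFaces_orderComplex {P : Type*} [PartialOrder P] [Fintype P] (i : ℕ) :
    numFaces (orderComplex P) i =
      (Finset.filter (fun s : Finset P => s.card = i)
        {s : Finset P | IsChain (· ≤ ·) (s : Set P)}).card := by
  rw [numFaces]
  split_ifs with h
  · subst h
    rw [eq_comm, Finset.card_eq_one]
    refine ⟨∅, ?_⟩
    ext s
    simp only [Finset.mem_filter, Finset.mem_univ, true_and, Finset.card_eq_zero,
      Finset.mem_singleton, and_iff_right_iff_imp]
    rintro rfl
    simp
  · rw [← Set.ncard_coe_finset]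
    congr 1
    ext s
    simp only [orderComplex, Set.mem_ofPred_eq, Finset.coe_filter, Finset.mem_filter,
      Finset.mem_univ, true_and]
    constructor
    · exact fun hs => ⟨hs.1.2, hs.2⟩
    · refine fun hs => ⟨⟨Finset.card_pos.mp ?_, hs.1⟩, hs.2⟩
      omega

/-- Each chain with `i` elements supports multichains with generating function `(z / (1 - z))^i`.
Multiplied by `(1 - z)^d` this is `z^i (1 - z)^(d - i)`, and there are `f_{i-1}` such chains. -/
theorem one_sub_X_pow_mul_multichains (P : Type*) [PartialOrder P] [Finite P] :
    (1 - X : PowerSeries ℤ) ^ dimSucc (orderComplex P) *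
      (PowerSeries.mk fun k => ((multichains P k).ncard : ℤ)) =
        (complexHPolynomial (orderComplex P) : Polynomial ℤ) := by
  classical
  have := Fintype.ofFinite P
  set d := dimSucc (orderComplex P)
  set g : PowerSeries ℤ := PowerSeries.mk fun k => if k = 0 then (0 : ℤ) else 1
  have hsum : (PowerSeries.mk fun k => ((multichains P k).ncard : ℤ)) =
      ∑ s ∈ Finset.univ.filter fun s : Finset P => IsChain (· ≤ ·) (s : Set P), g ^ s.card := by
    ext k
    rw [PowerSeries.coeff_mk, ncard_multichains, Nat.cast_sum, map_sum]
    refine Finset.sum_congr rfl fun s _ => ?_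
    rw [← mk_card_support_eq, PowerSeries.coeff_mk]
  have hmaps : ∀ s ∈ ({s : Finset P | IsChain (· ≤ ·) (s : Set P)} : Finset (Finset P)),
      s.card ∈ Finset.range (d + 1) := fun s hs =>
    Finset.mem_range_succ_iff.mpr (card_le_dimSucc (Finset.mem_filter.mp hs).2)
  rw [hsum, Finset.mul_sum, ← Finset.sum_fiberwise_of_maps_to hmaps, complexHPolynomial,
    ← Polynomial.coeToPowerSeries.ringHom_apply, map_sum]
  refine Finset.sum_congr rfl fun i hi => ?_
  have hid : i ≤ d := Finset.mem_range_succ_iff.mp hi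
  rw [Finset.sum_congr rfl (g := fun _ => X ^ i * (1 - X) ^ (d - i)), Finset.sum_const,
    ← numFaces_orderComplex]
  · have h := map_natCast (Polynomial.coeToPowerSeries.ringHom (R := ℤ))
      (numFaces (orderComplex P) i)
    rw [Polynomial.coeToPowerSeries.ringHom_apply] at h
    simp [mul_assoc, h, d]
  · intro s hs
    rw [(Finset.mem_filter.mp hs).2, ← Nat.sub_add_cancel hid, pow_add, mul_assoc, ← mul_pow,
      one_sub_X_mul_mk_ite, Nat.sub_add_cancel hid, mul_comm]

end GeneratingFunction

end CoverAlgebra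

/-! ### Equality of the two `h`-vectors -/

theorem proposition3p1 (K : Type*) [Field K] (n : ℕ) (G : SimpleGraph (Fin n ⊕ Fin n))
    (hbip : G.IsBipartiteWith (Set.range Sum.inl) (Set.range Sum.inr))
    (hiso : CoverAlgebra.NoIsolatedVertices G)
    (hunm : CoverAlgebra.IsUnmixed G) :
    (∀ k, Module.Finite K (CoverAlgebra.basicCoverComponent K G k)) ∧
    (∃ d : ℕ, ringKrullDim (CoverAlgebra.BasicCoverAlgebra K G) = d) ∧
    CoverAlgebra.algebraHVector (CoverAlgebra.basicCoverComponent K G) =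
      CoverAlgebra.complexHVector
        (CoverAlgebra.orderComplex (CoverAlgebra.coverLattice G)) := by
  open CoverAlgebra in
  have himage : ∀ k, coverSum G '' multichains (coverLattice G) k = minimalCovers G k := by
    intro k
    apply Set.Subset.antisymm
    · rintro _ ⟨m, ⟨-, rfl⟩, rfl⟩
      exact coverSum_mem hbip hiso hunm m
    · intro c hc
      exact exists_multichain_coverSum_eq hbip hiso hunm hc
  have hfin : ∀ k, (minimalCovers G k).Finite := by
    classical
    have := Fintype.ofFinite (coverLattice G)
    intro k
    rw [← himage]
    refine Set.Finite.image _ (((Finset.univ.finsuppAntidiag k).finite_toSet).subset ?_)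
    rintro m ⟨-, hm⟩
    simpa [Finsupp.degree_eq_sum] using hm
  have hcomp := fun k => finite_and_finrank_component (K := K) (G := G) (n := n)
    (fun _ _ hc => hc.le_degree hbip hiso hunm)
    (fun _ _ hc h => exists_isKVertexCover_sub_single hbip hiso hunm hc h) (hfin k)
  -- The cover `W` puts the full set into the lattice, so a longest chain is a genuine face even for
  -- `n = 0`.
  have hne : Nonempty (coverLattice G) :=
    ⟨⟨_, _, isMinimalVertexCover_range_inl hbip hiso, fun _ => Iff.rfl⟩⟩
  obtain ⟨s, hs, hcard⟩ := exists_isMaxChain_card_eq_dimSucc (coverLattice G)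
  have hdim := ringKrullDim_basicCoverAlgebra K hbip hiso hunm hs
  rw [hcard] at hdim
  refine ⟨fun k => (hcomp k).1, ⟨_, hdim⟩, ?_⟩
  have hseries : hilbertSeries (basicCoverComponent K G) =
      PowerSeries.mk fun k => ((multichains (coverLattice G) k).ncard : ℤ) := by
    ext k
    rw [hilbertSeries, PowerSeries.coeff_mk, PowerSeries.coeff_mk, (hcomp k).2,
      ← (coverSum_injOn k).ncard_image, himage]
    rfl
  funext j
  have hnat : ((ringKrullDim (BasicCoverAlgebra K G)).unbotD 0).toNat =
      dimSucc (orderComplex (coverLattice G)) := by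
    rw [hdim]
    rfl
  rw [algebraHVector, hseries, hnat, one_sub_X_pow_mul_multichains, Polynomial.coeff_coe]
  rfl
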